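/- Let $M\subset\mathbb{C}^d$ be a bounded, connected, embedded complex submanifold. Let $\mathsf{k}_M$ be its Kobayashi distance (the infimum of lengths of chains of holomorphic discs, with the Poincaré distance of $|dz|/(1-|z|^2)$ on the unit disc $\mathbb{D}$), let $\kappa_M(z,X)=\inf\{|v| : v\in\mathbb{C},\ \varphi:\mathbb{D}\to M \text{ holomorphic},\ \varphi(0)=z,\ \varphi'(0)v=X\}$ be its Kobayashi--Royden pseudometric, and let $\partial M=\overline{M}\setminus M$. Suppose that $(M,\mathsf{k}_M)$ is Cauchy complete. A real Kobayashi geodesic is a map $\sigma:[a,b]\to M$ with $\mathsf{k}_M(\sigma(s),\sigma(t))=|s-t|$ for all $s,t\in[a,b]$. For $\lambda\ge 1$ and $\kappa\ge 0$, a $(\lambda,\kappa)$-almost-geodesic is an absolutely continuous curve $\sigma:[a,b]\to M$ such that $\frac1\lambda|t-s|-\kappa\le \mathsf{k}_M(\sigma(t),\sigma(s))\le\lambda|t-s|+\kappa$ for all $s,t\in[a,b]$ and $\kappa_M(\sigma(t),\sigma'(t))\le\lambda$ for almost every $t\in[a,b]$. A class of curves $[a,b]\to M$ satisfies the visibility condition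 if for all $p\ne q$ in $\partial M$ there are $\mathbb{C}^d$-neighbourhoods $V$ of $p$ and $W$ of $q$ with $\overline V\cap\overline W=\emptyset$ and a compact set $K\subset M$ such that every curve of the class with initial point in $V$ and terminal point in $W$ meets $K$. $M$ is a BNT-visibility submanifold if $(M,\mathsf{k}_M)$ is Cauchy complete and the real Kobayashi geodesics satisfy the visibility condition. For $\kappa>0$, $M$ is a $(1,\kappa)$-visibility submanifold if any two distinct points of $M$ can be joined by a $(1,\kappa)$-almost-geodesic and the $(1,\kappa)$-almost-geodesics satisfy the visibility condition; for $\kappa=0$, $M$ is a $(1,0)$-visibility submanifold if the $(1,0)$-almost-geodesics satisfy the visibility condition. Then $M$ is a BNT-visibility submanifold if and only if $M$ is a $(1,\kappa)$-visibility submanifold for all $\kappa\ge 0$. -/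

import Mathlib

open Set Filter Topology MeasureTheory
open scoped ENNReal

noncomputable section

/-- Complex Euclidean space `ℂ^d` with its Euclidean norm. -/
abbrev CSpace (d : ℕ) : Type := EuclideanSpace ℂ (Fin d)

/-- The open unit disc in `ℂ`. -/
def unitDisc : Set ℂ := Metric.ball 0 1

/-- `M ⊆ ℂ^d` is an embedded complex submanifold (of some dimension `n`): near each of its points,
a biholomorphic change of coordinates of `ℂ^d` carries `M` to an `n`-dimensional complex linear
subspace. -/
def IsEmbeddedComplexSubmanifold {d : ℕ} (M : Set (CSpace d)) : Prop :=
  ∃ n : ℕ, ∀ p ∈ M, ∃ (Φ : OpenPartialHomeomorph (CSpace d) (CSpace d))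
    (L : Submodule ℂ (CSpace d)),
      p ∈ Φ.source ∧
      DifferentiableOn ℂ Φ Φ.source ∧
      DifferentiableOn ℂ Φ.symm Φ.target ∧
      Module.finrank ℂ L = n ∧
      ∀ x ∈ Φ.source, x ∈ M ↔ Φ x ∈ L

/-- A holomorphic map from the unit disc to `M`. As `M` is embedded, this is a
`ℂ^d`-valued holomorphic map whose image lies in `M`. -/
def IsHolomorphicDisc {d : ℕ} (M : Set (CSpace d)) (φ : ℂ → CSpace d) : Prop :=
  DifferentiableOn ℂ φ unitDisc ∧ MapsTo φ unitDisc M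

/-- The Poincaré distance on the unit disc, the integrated form of `|dz| / (1 - |z|^2)`. -/
def poincareDist (a b : ℂ) : ℝ :=
  Real.artanh (‖a - b‖ / ‖1 - (starRingEnd ℂ) b * a‖)

/-- `c` is the length of a finite chain of holomorphic discs in `M` from `z` to `w`: there are
points `z = p 0, …, p m = w` of `M`, discs `φ i` in `M` and points `a i`, `b i` of the unit disc
with `φ i (a i) = p i` and `φ i (b i) = p (i + 1)`, and `c` is the sum of the Poincaré distances
between `a i` and `b i`. -/
def IsChainLength {d : ℕ} (M : Set (CSpace d)) (z w : CSpace d) (c : ℝ) : Prop :=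
  ∃ (m : ℕ) (p : ℕ → CSpace d) (φ : ℕ → ℂ → CSpace d) (a b : ℕ → ℂ),
    p 0 = z ∧ p m = w ∧
    (∀ i < m, IsHolomorphicDisc M (φ i) ∧ a i ∈ unitDisc ∧ b i ∈ unitDisc ∧
      φ i (a i) = p i ∧ φ i (b i) = p (i + 1)) ∧
    c = ∑ i ∈ Finset.range m, poincareDist (a i) (b i)

/-- The Kobayashi distance `k_M` (meant for `z, w` in a connected complex submanifold `M`, where
any two points are joined by a chain of holomorphic discs). -/
def kobayashiDist {d : ℕ} (M : Set (CSpace d)) (z w : CSpace d) : ℝ :=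
  sInf {c : ℝ | IsChainLength M z w c}

/-- The Kobayashi--Royden pseudometric `κ_M(z, X)`: the infimum of `|v|` over all `v ∈ ℂ` for which
some holomorphic disc `φ` in `M` satisfies `φ 0 = z` and `φ'(0) v = X`
(it is `∞` if `X` is not tangent to `M` at `z`). -/
def kobayashiRoyden {d : ℕ} (M : Set (CSpace d)) (z X : CSpace d) : ℝ≥0∞ :=
  ⨅ (v : ℂ) (_ : ∃ φ : ℂ → CSpace d, IsHolomorphicDisc M φ ∧ φ 0 = z ∧ v • deriv φ 0 = X),
    ENNReal.ofReal ‖v‖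

/-- `(M, k_M)` is Cauchy complete. -/
def IsKobayashiComplete {d : ℕ} (M : Set (CSpace d)) : Prop :=
  ∀ u : ℕ → CSpace d, (∀ n, u n ∈ M) →
    (∀ ε > 0, ∃ N, ∀ m ≥ N, ∀ n ≥ N, kobayashiDist M (u m) (u n) < ε) →
    ∃ z ∈ M, Tendsto (fun n => kobayashiDist M (u n) z) atTop (𝓝 0)

/-- `σ : [a, b] → M` is a real Kobayashi geodesic, i.e. an isometry into `(M, k_M)`. -/
structure IsRealKobayashiGeodesic {d : ℕ} (M : Set (CSpace d)) (a b : ℝ)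
    (σ : ℝ → CSpace d) : Prop where
  le : a ≤ b
  mapsTo : MapsTo σ (Icc a b) M
  isometry : ∀ s ∈ Icc a b, ∀ t ∈ Icc a b, |s - t| = kobayashiDist M (σ s) (σ t)

/-- `σ : [a, b] → M` is a `(lam, kap)`-almost-geodesic. -/
structure IsAlmostGeodesic {d : ℕ} (M : Set (CSpace d)) (lam kap : ℝ) (a b : ℝ)
    (σ : ℝ → CSpace d) : Prop where
  le : a ≤ b
  mapsTo : MapsTo σ (Icc a b) M
  lower : ∀ s ∈ Icc a b, ∀ t ∈ Icc a b,
    (1 / lam) * |t - s| - kap ≤ kobayashiDist M (σ t) (σ s)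
  upper : ∀ s ∈ Icc a b, ∀ t ∈ Icc a b,
    kobayashiDist M (σ t) (σ s) ≤ lam * |t - s| + kap
  absolutelyContinuous : AbsolutelyContinuousOnInterval σ a b
  speed : ∀ᵐ t ∂(volume.restrict (Icc a b)),
    kobayashiRoyden M (σ t) (deriv σ t) ≤ ENNReal.ofReal lam

/-- The visibility condition for a class `Γ` of curves (`Γ a b σ` says that `σ` restricted to
`[a, b]` belongs to the class): for all distinct points `p, q` of `∂M = closure M \ M` there are
neighbourhoods `V`, `W` of `p`, `q` with disjoint closures and a compact subset `K` of `M` that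
meets every curve of the class which starts in `V` and ends in `W`. -/
def BendsInside {d : ℕ} (M : Set (CSpace d)) (Γ : ℝ → ℝ → (ℝ → CSpace d) → Prop) : Prop :=
  ∀ p ∈ closure M \ M, ∀ q ∈ closure M \ M, p ≠ q →
    ∃ V ∈ 𝓝 p, ∃ W ∈ 𝓝 q, ∃ K : Set (CSpace d),
      closure V ∩ closure W = ∅ ∧ IsCompact K ∧ K ⊆ M ∧
      ∀ (a b : ℝ) (σ : ℝ → CSpace d), Γ a b σ → σ a ∈ V → σ b ∈ W →
        ∃ t ∈ Icc a b, σ t ∈ K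

/-- Any two distinct points of `M` can be joined by a `(lam, kap)`-almost-geodesic. -/
def JoinedByAlmostGeodesics {d : ℕ} (M : Set (CSpace d)) (lam kap : ℝ) : Prop :=
  ∀ z ∈ M, ∀ w ∈ M, z ≠ w →
    ∃ (a b : ℝ) (σ : ℝ → CSpace d), IsAlmostGeodesic M lam kap a b σ ∧ σ a = z ∧ σ b = w

/-- `M` has the visibility property with respect to `(lam, kap)`-almost-geodesics. For `kap > 0`
this comprises both the existence of almost-geodesics and the visibility condition. For `kap = 0`
it is the visibility condition alone: in a complete `M`, real geodesics need not be
`(1, 0)`-almost-geodesics, since `κ_M(z, ·)` need not be convex. -/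
def IsVisibilitySubmanifold {d : ℕ} (M : Set (CSpace d)) (lam kap : ℝ) : Prop :=
  (0 < kap → JoinedByAlmostGeodesics M lam kap) ∧
  BendsInside M (IsAlmostGeodesic M lam kap)

/-- `M` is a BNT-visibility submanifold. -/
def IsBNTVisibilitySubmanifold {d : ℕ} (M : Set (CSpace d)) : Prop :=
  IsKobayashiComplete M ∧ BendsInside M (IsRealKobayashiGeodesic M)

end

/-! Completeness makes (M, k_M) a proper geodesic space by Hopf–Rinow: chains of discs give nearly
shortest curves, and k_M induces the subspace topology. Write (x|y) = (k(o,x) + k(o,y) - k(x,y))/2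
for the Gromov product at a base point o. If geodesics bend inside M, then (x|y) is bounded for x, y
near distinct boundary points (`BendsInside.exists_gromov_bound`).

From geodesics to almost-geodesics: suppose almost-geodesics from x_n → p to y_n → q leave every
ball about o. Choose z_n on the n-th curve with k(x_n,z_n) = k(o,x_n). A limit point ξ of (z_n) lies
in ∂M and differs from p or from q. The Gromov bound for (x_n,z_n) or for (z_n,y_n), respectively,
then bounds k(o,z_n), which is absurd.

Conversely, a real geodesic need not satisfy the speed condition. It is replaced by a chain of
hyperbolic geodesics in discs with total excess length below κ, staying within distance 1 + κ of it.
This curve is a (1,κ)-almost-geodesic and so meets a compact set; hence the geodesic meets a larger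
Kobayashi ball, which is compact. -/

/-! ### Disc automorphisms and the Poincaré distance -/

/-- The automorphism of the unit disc that takes `0` to `a`. -/
noncomputable def discAut (a z : ℂ) : ℂ := (z + a) / (1 + (starRingEnd ℂ) a * z)

lemma mem_unitDisc {z : ℂ} : z ∈ unitDisc ↔ ‖z‖ < 1 := by simp [unitDisc]

lemma isOpen_unitDisc : IsOpen unitDisc := Metric.isOpen_ball

lemma zero_mem_unitDisc : (0 : ℂ) ∈ unitDisc := by simp [unitDisc]

lemma one_add_conj_mul_ne_zero {a z : ℂ} (ha : a ∈ unitDisc) (hz : z ∈ unitDisc) :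
    1 + (starRingEnd ℂ) a * z ≠ 0 := by
  rw [mem_unitDisc] at ha hz
  intro h
  have h1 : (starRingEnd ℂ) a * z = -1 := by linear_combination h
  have h2 : ‖a‖ * ‖z‖ = 1 := by simpa using congrArg norm h1
  nlinarith [norm_nonneg a, norm_nonneg z]

/-- The identity behind `discAut_mem`: its right side is positive when both points lie in the disc.
-/
lemma normSq_one_add_conj_mul_sub (a z : ℂ) :
    ‖1 + (starRingEnd ℂ) a * z‖ ^ 2 - ‖z + a‖ ^ 2 = (1 - ‖a‖ ^ 2) * (1 - ‖z‖ ^ 2) := by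
  simp only [← Complex.normSq_eq_norm_sq, Complex.normSq_apply]
  simp
  ring

lemma discAut_mem {a z : ℂ} (ha : a ∈ unitDisc) (hz : z ∈ unitDisc) :
    discAut a z ∈ unitDisc := by
  have h0 := one_add_conj_mul_ne_zero ha hz
  have h := normSq_one_add_conj_mul_sub a z
  rw [mem_unitDisc] at ha hz ⊢
  have hpos : 0 < ‖1 + (starRingEnd ℂ) a * z‖ := norm_pos_iff.2 h0
  rw [discAut, norm_div, div_lt_one hpos]
  have h1 : 0 < (1 - ‖a‖ ^ 2) * (1 - ‖z‖ ^ 2) :=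
    mul_pos (by nlinarith [norm_nonneg a]) (by nlinarith [norm_nonneg z])
  exact lt_of_pow_lt_pow_left₀ 2 hpos.le (by linarith)

@[simp] lemma discAut_zero (a : ℂ) : discAut a 0 = a := by simp [discAut]

lemma hasDerivAt_discAut {a z : ℂ} (ha : a ∈ unitDisc) (hz : z ∈ unitDisc) :
    HasDerivAt (discAut a) ((1 * (1 + (starRingEnd ℂ) a * z) - (z + a) * ((starRingEnd ℂ) a * 1)) /
      (1 + (starRingEnd ℂ) a * z) ^ 2) z :=
  ((hasDerivAt_id z).add_const a).div
    (((hasDerivAt_id z).const_mul ((starRingEnd ℂ) a)).const_add 1)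
    (one_add_conj_mul_ne_zero ha hz)

lemma differentiableOn_discAut {a : ℂ} (ha : a ∈ unitDisc) :
    DifferentiableOn ℂ (discAut a) unitDisc :=
  fun _ hz => (hasDerivAt_discAut ha hz).differentiableAt.differentiableWithinAt

lemma neg_mem_unitDisc {a : ℂ} (ha : a ∈ unitDisc) : -a ∈ unitDisc := by
  rw [mem_unitDisc] at *; simpa using ha

lemma discAut_discAut_neg {a z : ℂ} (ha : a ∈ unitDisc) (hz : z ∈ unitDisc) :
    discAut a (discAut (-a) z) = z := by
  have h1 := one_add_conj_mul_ne_zero (neg_mem_unitDisc ha) hz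
  have h2 := one_add_conj_mul_ne_zero ha (discAut_mem (neg_mem_unitDisc ha) hz)
  rw [discAut, div_eq_iff h2, discAut]
  have h3 := div_mul_cancel₀ (z + -a) h1
  rw [map_neg] at h3 ⊢
  linear_combination h3

lemma poincareDist_comm (a b : ℂ) : poincareDist a b = poincareDist b a := by
  unfold poincareDist
  rw [norm_sub_rev a b, ← Complex.norm_conj (1 - _)]
  simp [mul_comm]

lemma poincareDist_nonneg (a b : ℂ) : 0 ≤ poincareDist a b :=
  Real.artanh_nonneg (by positivity)

section

variable {d : ℕ} {M : Set (CSpace d)}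

lemma IsHolomorphicDisc.comp {φ : ℂ → CSpace d} (hφ : IsHolomorphicDisc M φ) {f : ℂ → ℂ}
    (hf : DifferentiableOn ℂ f unitDisc) (hm : MapsTo f unitDisc unitDisc) :
    IsHolomorphicDisc M (fun z => φ (f z)) :=
  ⟨hφ.1.comp hf hm, hφ.2.comp hm⟩

/-- Up to an automorphism, two points of the disc are `0` and a point of `[0, 1)`. -/
lemma IsHolomorphicDisc.exists_normalized {φ : ℂ → CSpace d} (hφ : IsHolomorphicDisc M φ)
    {a b : ℂ} (ha : a ∈ unitDisc) (hb : b ∈ unitDisc) :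
    ∃ ψ : ℂ → CSpace d, ∃ l : ℝ, IsHolomorphicDisc M ψ ∧ 0 ≤ l ∧ ψ 0 = φ a ∧
      ψ (Real.tanh l : ℝ) = φ b ∧ l = poincareDist a b := by
  set w := discAut (-a) b with hw
  have hwm : w ∈ unitDisc := discAut_mem (neg_mem_unitDisc ha) hb
  have hwn := mem_unitDisc.1 hwm
  -- A rotation by `u` turns `w` into its modulus, so that the second point becomes `tanh l`.
  obtain ⟨u, hu, huw⟩ : ∃ u : ℂ, ‖u‖ = 1 ∧ u * (‖w‖ : ℂ) = w := by
    by_cases h : w = 0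
    · exact ⟨1, by simp, by simp [h]⟩
    · have : (‖w‖ : ℂ) ≠ 0 := by simpa using h
      exact ⟨w / ‖w‖, by simp [h], by field_simp⟩
  have hnorm : ‖w‖ = ‖a - b‖ / ‖1 - (starRingEnd ℂ) b * a‖ := by
    rw [hw, discAut, norm_div, norm_sub_rev a b, ← Complex.norm_conj (1 - _)]
    simp [sub_eq_add_neg, mul_comm]
  have hrot : DifferentiableOn ℂ (fun z => u * z) unitDisc := by fun_prop
  have hrotm : MapsTo (fun z => u * z) unitDisc unitDisc := by
    intro z hz
    rw [mem_unitDisc] at *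
    simpa [hu] using hz
  refine ⟨fun z => φ (discAut a (u * z)), Real.artanh ‖w‖, ?_, Real.artanh_nonneg (norm_nonneg _),
    by simp, ?_, by rw [hnorm]; rfl⟩
  · exact (hφ.comp (differentiableOn_discAut ha) fun z hz => discAut_mem ha hz).comp hrot hrotm
  · rw [Real.tanh_artanh ⟨by linarith [norm_nonneg w], hwn⟩]
    beta_reduce
    rw [huw, hw, discAut_discAut_neg ha hb]

/-! ### Hyperbolic geodesics parametrized by tanh -/

lemma hasDerivAt_tanh (t : ℝ) : HasDerivAt Real.tanh (1 - Real.tanh t ^ 2) t := by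
  have h := (Real.hasDerivAt_sinh t).div (Real.hasDerivAt_cosh t) (Real.cosh_pos t).ne'
  have h1 : (fun x => Real.sinh x / Real.cosh x) = Real.tanh := by
    ext x; rw [Real.tanh_eq_sinh_div_cosh]
  have h2 : Real.sinh / Real.cosh = Real.tanh := h1
  rw [h2] at h
  refine h.congr_deriv ?_
  rw [Real.tanh_eq_sinh_div_cosh]
  have := (Real.cosh_pos t).ne'
  field_simp

lemma tanh_sub_div (s t : ℝ) :
    (Real.tanh s - Real.tanh t) / (1 - Real.tanh t * Real.tanh s) = Real.tanh (s - t) := by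
  have h1 := (Real.cosh_pos s).ne'
  have h2 := (Real.cosh_pos t).ne'
  have h3 := (Real.cosh_pos (s - t)).ne'
  rw [Real.cosh_sub] at h3
  simp only [Real.tanh_eq_sinh_div_cosh, Real.sinh_sub, Real.cosh_sub]
  have h4 : 1 - Real.sinh t / Real.cosh t * (Real.sinh s / Real.cosh s) =
      (Real.cosh s * Real.cosh t - Real.sinh s * Real.sinh t) / (Real.cosh s * Real.cosh t) := by
    field_simp
  rw [h4]
  field_simp

lemma tanh_ofReal_mem_unitDisc (t : ℝ) : ((Real.tanh t : ℝ) : ℂ) ∈ unitDisc := by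
  rw [mem_unitDisc, Complex.norm_real]
  exact Real.abs_tanh_lt_one t

lemma tanh_nonneg {t : ℝ} (ht : 0 ≤ t) : 0 ≤ Real.tanh t := by
  rw [Real.tanh_eq_sinh_div_cosh]
  exact div_nonneg (Real.sinh_nonneg_iff.2 ht) (Real.cosh_pos t).le

lemma abs_tanh (t : ℝ) : |Real.tanh t| = Real.tanh |t| := by
  rcases le_total 0 t with h | h
  · rw [abs_of_nonneg h, abs_of_nonneg (tanh_nonneg h)]
  · rw [abs_of_nonpos h, Real.tanh_neg, abs_of_nonpos]
    have := tanh_nonneg (neg_nonneg.2 h)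
    rw [Real.tanh_neg] at this
    linarith

lemma poincareDist_tanh (s t : ℝ) :
    poincareDist (Real.tanh s : ℝ) (Real.tanh t : ℝ) = |s - t| := by
  unfold poincareDist
  rw [← norm_div, Complex.conj_ofReal]
  have : ((Real.tanh s : ℝ) - (Real.tanh t : ℝ) : ℂ) / (1 - (Real.tanh t : ℝ) * (Real.tanh s : ℝ)) =
      ((Real.tanh (s - t) : ℝ) : ℂ) := by
    rw [← tanh_sub_div]; push_cast; rfl
  rw [this, Complex.norm_real, Real.norm_eq_abs, abs_tanh, Real.artanh_tanh]

lemma tanh_le_self {t : ℝ} (ht : 0 ≤ t) : Real.tanh t ≤ t := by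
  have h := (convex_Icc (0 : ℝ) t).image_sub_le_mul_sub_of_deriv_le (f := Real.tanh) (C := 1)
    (fun x _ => (hasDerivAt_tanh x).continuousAt.continuousWithinAt)
    (fun x _ => (hasDerivAt_tanh x).differentiableAt.differentiableWithinAt)
    (fun x _ => by rw [(hasDerivAt_tanh x).deriv]; nlinarith [sq_nonneg (Real.tanh x)])
    0 ⟨le_rfl, ht⟩ t ⟨ht, le_rfl⟩ ht
  simpa using h

/-- The hyperbolic geodesic `t ↦ ψ (tanh t)` in a holomorphic disc has Kobayashi speed at
most one. -/
lemma IsHolomorphicDisc.kobayashiRoyden_tanh_le {ψ : ℂ → CSpace d} (hψ : IsHolomorphicDisc M ψ)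
    (t : ℝ) : kobayashiRoyden M (ψ (Real.tanh t : ℝ))
      (deriv (fun s : ℝ => ψ (Real.tanh s : ℝ)) t) ≤ 1 := by
  set a : ℂ := ((Real.tanh t : ℝ) : ℂ) with ha
  have ham : a ∈ unitDisc := tanh_ofReal_mem_unitDisc t
  have hd : HasDerivAt ψ (deriv ψ a) a :=
    (hψ.1.differentiableAt (isOpen_unitDisc.mem_nhds ham)).hasDerivAt
  have h1 : HasDerivAt (fun z => ψ (discAut a z)) ((1 - a ^ 2) • deriv ψ a) 0 := by
    have hd' : HasDerivAt ψ (deriv ψ a) (discAut a 0) := by simpa using hd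
    have := hd'.scomp 0 (hasDerivAt_discAut ham zero_mem_unitDisc)
    refine this.congr_deriv ?_
    have hc : (starRingEnd ℂ) a = a := Complex.conj_ofReal _
    simp [hc, sq]
  have h2 : HasDerivAt (fun s : ℝ => ψ (Real.tanh s : ℝ)) ((1 - a ^ 2) • deriv ψ a) t := by
    have := hd.scomp t ((hasDerivAt_tanh t).ofReal_comp)
    refine this.congr_deriv ?_
    simp [ha]
  have h3 : ∃ φ : ℂ → CSpace d, IsHolomorphicDisc M φ ∧ φ 0 = ψ a ∧
      (1 : ℂ) • deriv φ 0 = deriv (fun s : ℝ => ψ (Real.tanh s : ℝ)) t :=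
    ⟨fun z => ψ (discAut a z), hψ.comp (differentiableOn_discAut ham)
      fun z hz => discAut_mem ham hz, by simp, by rw [h1.deriv, h2.deriv, one_smul]⟩
  refine (iInf₂_le (1 : ℂ) h3).trans ?_
  simp

/-! ### Chains of discs and the Kobayashi distance -/

lemma IsChainLength.refl (z : CSpace d) : IsChainLength M z z 0 :=
  ⟨0, fun _ => z, fun _ _ => 0, fun _ => 0, fun _ => 0, rfl, rfl, by simp, by simp⟩

lemma IsChainLength.snoc {z w : CSpace d} {c : ℝ} (h : IsChainLength M z w c) {φ : ℂ → CSpace d}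
    {a b : ℂ} (hφ : IsHolomorphicDisc M φ) (ha : a ∈ unitDisc) (hb : b ∈ unitDisc)
    (haw : φ a = w) : IsChainLength M z (φ b) (c + poincareDist a b) := by
  obtain ⟨m, p, ψ, a', b', h0, hm, hi, hc⟩ := h
  refine ⟨m + 1, fun i => if i ≤ m then p i else φ b, fun i => if i < m then ψ i else φ,
    fun i => if i < m then a' i else a, fun i => if i < m then b' i else b, by simp [h0], by simp,
    ?_, ?_⟩
  · intro i him
    rcases Nat.lt_succ_iff_lt_or_eq.1 him with him | rfl
    · have h1 : i ≤ m := him.le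
      have h2 : i + 1 ≤ m := him
      simpa [him, h1, h2] using hi i him
    · simp [hφ, ha, hb, haw, hm]
  · rw [Finset.sum_range_succ, hc]
    congr 1
    · refine Finset.sum_congr rfl fun i hi => ?_
      simp [Finset.mem_range.1 hi]
    · simp

/-- Each prefix of a chain is a chain, so one may induct on the last disc and forget the indexed
data. -/
theorem IsChainLength.induction {z : CSpace d} {P : CSpace d → ℝ → Prop} (h0 : P z 0)
    (hs : ∀ (w : CSpace d) (c : ℝ) (φ : ℂ → CSpace d) (a b : ℂ), IsChainLength M z w c → P w c →
      IsHolomorphicDisc M φ → a ∈ unitDisc → b ∈ unitDisc → φ a = w →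
      P (φ b) (c + poincareDist a b)) {w : CSpace d} {c : ℝ} (h : IsChainLength M z w c) :
    P w c := by
  obtain ⟨m, p, ψ, a, b, hz, hm, hi, hc⟩ := h
  have key : ∀ n ≤ m, P (p n) (∑ i ∈ Finset.range n, poincareDist (a i) (b i)) := by
    intro n
    induction n with
    | zero => intro _; simpa [hz] using h0
    | succ n ih =>
      intro hn
      obtain ⟨h1, h2, h3, h4, h5⟩ := hi n hn
      rw [Finset.sum_range_succ, ← h5]
      refine hs (p n) _ (ψ n) (a n) (b n) ?_ (ih (by omega)) h1 h2 h3 h4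
      exact ⟨n, p, ψ, a, b, hz, rfl, fun i hin => hi i (by omega), rfl⟩
  rw [← hm, hc]
  exact key m le_rfl

lemma IsChainLength.nonneg {z w : CSpace d} {c : ℝ} (h : IsChainLength M z w c) : 0 ≤ c :=
  IsChainLength.induction (P := fun _ c => 0 ≤ c) le_rfl
    (fun _ _ _ a b _ hc _ _ _ _ => add_nonneg hc (poincareDist_nonneg a b)) h

lemma IsChainLength.trans {z w v : CSpace d} {c c' : ℝ} (h : IsChainLength M z w c)
    (h' : IsChainLength M w v c') : IsChainLength M z v (c + c') := by
  refine IsChainLength.induction (P := fun v c' => IsChainLength M z v (c + c')) (by simpa using h)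
    (fun w c φ a b _ ih hφ ha hb haw => ?_) h'
  rw [← add_assoc]
  exact ih.snoc hφ ha hb haw

lemma IsHolomorphicDisc.isChainLength {φ : ℂ → CSpace d} {a b : ℂ} (hφ : IsHolomorphicDisc M φ)
    (ha : a ∈ unitDisc) (hb : b ∈ unitDisc) :
    IsChainLength M (φ a) (φ b) (poincareDist a b) := by
  simpa using (IsChainLength.refl (φ a)).snoc hφ ha hb rfl

lemma IsChainLength.symm {z w : CSpace d} {c : ℝ} (h : IsChainLength M z w c) :
    IsChainLength M w z c := by
  refine IsChainLength.induction (P := fun w c => IsChainLength M w z c) (IsChainLength.refl z)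
    (fun w c φ a b _ ih hφ ha hb haw => ?_) h
  rw [add_comm, poincareDist_comm]
  subst haw
  exact (hφ.isChainLength hb ha).trans ih

lemma bddBelow_chainLength (z w : CSpace d) : BddBelow {c : ℝ | IsChainLength M z w c} :=
  ⟨0, fun _ hc => IsChainLength.nonneg hc⟩

lemma IsChainLength.kobayashiDist_le {z w : CSpace d} {c : ℝ} (h : IsChainLength M z w c) :
    kobayashiDist M z w ≤ c := csInf_le (bddBelow_chainLength z w) h

lemma kobayashiDist_nonneg (z w : CSpace d) : 0 ≤ kobayashiDist M z w :=
  Real.sInf_nonneg fun _ hc => IsChainLength.nonneg hc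

lemma kobayashiDist_self (z : CSpace d) : kobayashiDist M z z = 0 :=
  le_antisymm (IsChainLength.refl z).kobayashiDist_le (kobayashiDist_nonneg z z)

lemma kobayashiDist_comm (z w : CSpace d) : kobayashiDist M z w = kobayashiDist M w z :=
  congrArg sInf (Set.ext fun _ => ⟨IsChainLength.symm, IsChainLength.symm⟩)

/-! ### Comparison with the Euclidean topology -/

/-- Points of `M` near `p` are joined to `p` by short holomorphic discs. -/
lemma IsEmbeddedComplexSubmanifold.eventually_isChainLength
    (hM : IsEmbeddedComplexSubmanifold M) {p : CSpace d} (hp : p ∈ M) {ε : ℝ} (hε : 0 < ε) :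
    ∀ᶠ z in 𝓝[M] p, ∃ c < ε, IsChainLength M p z c := by
  obtain ⟨n, hM⟩ := hM
  obtain ⟨Φ, L, hpΦ, hΦ, hΦ', -, hL⟩ := hM p hp
  have hpt : Φ p ∈ Φ.target := Φ.map_source hpΦ
  obtain ⟨r, hr, hball⟩ := Metric.isOpen_iff.1 Φ.open_target _ hpt
  have hδ0 : 0 < Real.tanh (ε / 2) := by
    rw [Real.tanh_eq_sinh_div_cosh]
    exact div_pos (Real.sinh_pos_iff.2 (by linarith)) (Real.cosh_pos _)
  -- The point `δ` has Poincaré distance ε/2 from 0. The disc below is affine in the chart and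
  -- reaches `z` at `δ`; the bound `δ * r` on the displacement keeps it in the ball of radius `r`.
  set δ := Real.tanh (ε / 2) with hδ
  have hcont : ContinuousAt Φ p := Φ.continuousAt hpΦ
  have hev : ∀ᶠ z in 𝓝 p, Φ z ∈ Metric.ball (Φ p) (δ * r) :=
    hcont.eventually (Metric.ball_mem_nhds _ (by positivity))
  filter_upwards [self_mem_nhdsWithin, mem_nhdsWithin_of_mem_nhds hev,
    mem_nhdsWithin_of_mem_nhds (Φ.open_source.mem_nhds hpΦ)] with z hzM hz hzs
  set X := Φ z - Φ p with hX
  have hXn : ‖X‖ < δ * r := by simpa [dist_eq_norm] using hz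
  have hXL : X ∈ L := L.sub_mem ((hL z hzs).1 hzM) ((hL p hpΦ).1 hp)
  let g : ℂ → CSpace d := fun ζ => Φ p + (ζ / δ) • X
  have hg : Differentiable ℂ g := by fun_prop
  have hgt : MapsTo g unitDisc Φ.target := by
    intro ζ hζ
    apply hball
    rw [mem_unitDisc] at hζ
    rw [Metric.mem_ball, dist_eq_norm]
    simp only [g, add_sub_cancel_left, norm_smul, norm_div, Complex.norm_real,
      Real.norm_of_nonneg hδ0.le]
    calc ‖ζ‖ / δ * ‖X‖ ≤ 1 / δ * ‖X‖ := by gcongr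
      _ < 1 / δ * (δ * r) := by gcongr
      _ = r := by field_simp
  have hdisc : IsHolomorphicDisc M (fun ζ => Φ.symm (g ζ)) := by
    refine ⟨hΦ'.comp hg.differentiableOn hgt, fun ζ hζ => ?_⟩
    refine (hL _ (Φ.map_target (hgt hζ))).2 ?_
    rw [Φ.right_inv (hgt hζ)]
    exact L.add_mem ((hL p hpΦ).1 hp) (L.smul_mem _ hXL)
  have h0 : Φ.symm (g 0) = p := by simp [g, Φ.left_inv hpΦ]
  have h1 : Φ.symm (g (δ : ℂ)) = z := by
    have : (δ : ℂ) ≠ 0 := by exact_mod_cast hδ0.ne'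
    simp [g, this, hX, Φ.left_inv hzs]
  have h2 := hdisc.isChainLength zero_mem_unitDisc (tanh_ofReal_mem_unitDisc (ε / 2))
  rw [← hδ, h0, h1] at h2
  refine ⟨_, ?_, h2⟩
  have h3 := poincareDist_tanh 0 (ε / 2)
  rw [Real.tanh_zero, Complex.ofReal_zero, ← hδ] at h3
  rw [h3, zero_sub, abs_neg, abs_of_pos (by linarith)]
  linarith

/-- Being joined by a chain is an equivalence relation with open classes in M. Nonemptiness matters
because the real `sInf` of the empty set is 0. -/
lemma exists_isChainLength (hM : IsEmbeddedComplexSubmanifold M) (hconn : IsConnected M)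
    {z w : CSpace d} (hz : z ∈ M) (hw : w ∈ M) : ∃ c, IsChainLength M z w c := by
  refine hconn.isPreconnected.induction₂' (fun z w => ∃ c, IsChainLength M z w c) ?_ ?_ hz hw
  · intro x hx
    filter_upwards [hM.eventually_isChainLength hx one_pos] with y hy
    obtain ⟨c, -, hc⟩ := hy
    exact ⟨⟨c, hc⟩, ⟨c, hc.symm⟩⟩
  · rintro x y z - - - ⟨c, hc⟩ ⟨c', hc'⟩
    exact ⟨_, hc.trans hc'⟩

lemma exists_isChainLength_lt (hM : IsEmbeddedComplexSubmanifold M) (hconn : IsConnected M)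
    {z w : CSpace d} (hz : z ∈ M) (hw : w ∈ M) {r : ℝ} (hr : kobayashiDist M z w < r) :
    ∃ c < r, IsChainLength M z w c := by
  obtain ⟨c, hc, hcr⟩ := exists_lt_of_csInf_lt (exists_isChainLength hM hconn hz hw) hr
  exact ⟨c, hcr, hc⟩

lemma kobayashiDist_triangle (hM : IsEmbeddedComplexSubmanifold M) (hconn : IsConnected M)
    {x y z : CSpace d} (hx : x ∈ M) (hy : y ∈ M) (hz : z ∈ M) :
    kobayashiDist M x z ≤ kobayashiDist M x y + kobayashiDist M y z := by
  refine le_of_forall_pos_lt_add fun ε hε => ?_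
  obtain ⟨c, hc, h⟩ := exists_isChainLength_lt hM hconn hx hy
    (lt_add_of_pos_right _ (half_pos hε))
  obtain ⟨c', hc', h'⟩ := exists_isChainLength_lt hM hconn hy hz
    (lt_add_of_pos_right _ (half_pos hε))
  linarith [(h.trans h').kobayashiDist_le]

/-- On a bounded set the Kobayashi distance dominates a multiple of the Euclidean distance. -/
lemma exists_dist_le_mul_kobayashiDist (hM : IsEmbeddedComplexSubmanifold M)
    (hconn : IsConnected M) (hbdd : Bornology.IsBounded M) :
    ∃ C : ℝ, 0 < C ∧ ∀ z ∈ M, ∀ w ∈ M, dist z w ≤ C * kobayashiDist M z w := by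
  obtain ⟨C, hC⟩ := Metric.isBounded_iff.1 hbdd
  refine ⟨max C 1, by positivity, fun z hz w hw => ?_⟩
  have key : ∀ {w : CSpace d} {c : ℝ}, IsChainLength M z w c → dist z w ≤ max C 1 * c := by
    intro w c h
    refine IsChainLength.induction (P := fun w c => dist z w ≤ max C 1 * c) (by simp) ?_ h
    intro w c φ a b _ ih hφ ha hb haw
    obtain ⟨ψ, l, hψ, hl, h0, h1, hlp⟩ := hφ.exists_normalized ha hb
    -- Schwarz lemma: each disc has its image in a ball about its centre whose radius depends only
    -- on the diameter of M.
    have hS := Complex.dist_le_div_mul_dist_of_mapsTo_ball (R₂ := max C 1) hψ.1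
      (fun ζ hζ => Metric.mem_closedBall.2 ((hC (hψ.2 hζ)
        (hψ.2 zero_mem_unitDisc)).trans (le_max_left _ _))) (tanh_ofReal_mem_unitDisc l)
    rw [h0, h1, dist_zero_right, Complex.norm_real, Real.norm_of_nonneg (tanh_nonneg hl), div_one,
      haw, dist_comm] at hS
    calc dist z (φ b) ≤ dist z w + dist w (φ b) := dist_triangle _ _ _
      _ ≤ max C 1 * c + max C 1 * l :=
        add_le_add ih (hS.trans (mul_le_mul_of_nonneg_left (tanh_le_self hl) (by positivity)))
      _ = max C 1 * (c + poincareDist a b) := by rw [← hlp]; ring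
  rw [← div_le_iff₀' (by positivity)]
  refine le_csInf (exists_isChainLength hM hconn hz hw) fun c hc => ?_
  rw [div_le_iff₀' (by positivity)]
  exact key hc

lemma tendsto_kobayashiDist (hM : IsEmbeddedComplexSubmanifold M) {p : CSpace d} (hp : p ∈ M) :
    Tendsto (fun z => kobayashiDist M p z) (𝓝[M] p) (𝓝 0) := by
  rw [Metric.tendsto_nhds]
  intro ε hε
  filter_upwards [hM.eventually_isChainLength hp hε] with z hz
  obtain ⟨c, hc, h⟩ := hz
  rw [Real.dist_0_eq_abs, abs_of_nonneg (kobayashiDist_nonneg _ _)]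
  exact h.kobayashiDist_le.trans_lt hc

/-- In a chart M is the preimage of a closed linear subspace. This supplies the local compactness
for Hopf–Rinow. -/
lemma IsEmbeddedComplexSubmanifold.isLocallyClosed (hM : IsEmbeddedComplexSubmanifold M) :
    IsLocallyClosed M := by
  obtain ⟨n, hM⟩ := hM
  refine ((isLocallyClosed_tfae M).out 0 2).2 fun p hp => ?_
  obtain ⟨Φ, L, hpΦ, -, -, -, hL⟩ := hM p hp
  refine ⟨Φ.source, Φ.open_source.mem_nhds hpΦ, ?_⟩
  have hc : Continuous (fun x : Φ.source => Φ x) :=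
    continuousOn_iff_continuous_domRestrict.1 Φ.continuousOn
  have : (Subtype.val ⁻¹' M : Set Φ.source) =
      (fun x : Φ.source => Φ x) ⁻¹' (L : Set (CSpace d)) := by
    ext x
    exact hL x x.2
  rw [this]
  exact L.closed_of_finiteDimensional.preimage hc

/-! ### Unit speed curves from chains of discs -/

/-- A curve `[0, l] → M` that is `1`-Lipschitz for the Kobayashi distance and has
Kobayashi--Royden speed at most `1` outside a countable set. -/
structure IsUnitSpeedCurve (M : Set (CSpace d)) (l : ℝ) (γ : ℝ → CSpace d) : Prop where
  nonneg : 0 ≤ l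
  mapsTo : MapsTo γ (Icc 0 l) M
  dist_le : ∀ s ∈ Icc 0 l, ∀ t ∈ Icc 0 l, kobayashiDist M (γ s) (γ t) ≤ |s - t|
  speed : ∃ S : Set ℝ, S.Countable ∧
    ∀ t ∈ Ioo 0 l, t ∉ S → kobayashiRoyden M (γ t) (deriv γ t) ≤ 1

/-- The concatenation of a curve on `[0, l]` with a second curve. -/
noncomputable def concatCurve (l : ℝ) (γ₁ γ₂ : ℝ → CSpace d) (t : ℝ) : CSpace d :=
  if t ≤ l then γ₁ t else γ₂ (t - l)

lemma concatCurve_of_le {l t : ℝ} (γ₁ γ₂ : ℝ → CSpace d) (h : t ≤ l) :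
    concatCurve l γ₁ γ₂ t = γ₁ t := if_pos h

lemma concatCurve_of_ge {l t : ℝ} {γ₁ γ₂ : ℝ → CSpace d} (h0 : γ₁ l = γ₂ 0) (h : l ≤ t) :
    concatCurve l γ₁ γ₂ t = γ₂ (t - l) := by
  rcases h.eq_or_lt with rfl | h
  · rw [concatCurve_of_le _ _ le_rfl, sub_self, h0]
  · exact if_neg (not_le.2 h)

/-- Across the junction the Lipschitz bound follows from the triangle inequality; the junction
itself joins the countable exceptional set. -/
lemma IsUnitSpeedCurve.concat (hM : IsEmbeddedComplexSubmanifold M) (hconn : IsConnected M)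
    {l₁ l₂ : ℝ} {γ₁ γ₂ : ℝ → CSpace d} (h₁ : IsUnitSpeedCurve M l₁ γ₁)
    (h₂ : IsUnitSpeedCurve M l₂ γ₂) (h0 : γ₁ l₁ = γ₂ 0) :
    IsUnitSpeedCurve M (l₁ + l₂) (concatCurve l₁ γ₁ γ₂) := by
  have n₁ := h₁.nonneg
  have n₂ := h₂.nonneg
  have hmaps : MapsTo (concatCurve l₁ γ₁ γ₂) (Icc 0 (l₁ + l₂)) M := by
    intro t ht
    rcases le_total t l₁ with h | h
    · rw [concatCurve_of_le _ _ h]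
      exact h₁.mapsTo ⟨ht.1, h⟩
    · rw [concatCurve_of_ge h0 h]
      exact h₂.mapsTo ⟨by linarith, by linarith [ht.2]⟩
  have hle : ∀ s ∈ Icc 0 (l₁ + l₂), ∀ t ∈ Icc 0 (l₁ + l₂), s ≤ t →
      kobayashiDist M (concatCurve l₁ γ₁ γ₂ s) (concatCurve l₁ γ₁ γ₂ t) ≤ t - s := by
    rintro s ⟨hs0, hs⟩ t ⟨ht0, ht⟩ hst
    rcases le_total t l₁ with htl | htl
    · rw [concatCurve_of_le _ _ htl, concatCurve_of_le _ _ (hst.trans htl)]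
      refine (h₁.dist_le s ⟨hs0, hst.trans htl⟩ t ⟨ht0, htl⟩).trans_eq ?_
      rw [abs_sub_comm, abs_of_nonneg (by linarith)]
    · rw [concatCurve_of_ge h0 htl]
      rcases le_total s l₁ with hsl | hsl
      · rw [concatCurve_of_le _ _ hsl]
        have a1 := h₁.dist_le s ⟨hs0, hsl⟩ l₁ ⟨n₁, le_rfl⟩
        have a2 := h₂.dist_le 0 ⟨le_rfl, n₂⟩ (t - l₁) ⟨by linarith, by linarith⟩
        rw [abs_sub_comm, abs_of_nonneg (by linarith)] at a1 a2
        have a3 := kobayashiDist_triangle hM hconn (h₁.mapsTo ⟨hs0, hsl⟩)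
          (h₁.mapsTo ⟨n₁, le_refl l₁⟩)
          (h₂.mapsTo (x := t - l₁) ⟨by linarith, by linarith⟩)
        rw [← h0] at a2
        linarith
      · rw [concatCurve_of_ge h0 hsl]
        refine (h₂.dist_le (s - l₁) ⟨by linarith, by linarith⟩ (t - l₁)
          ⟨by linarith, by linarith⟩).trans_eq ?_
        rw [abs_sub_comm, abs_of_nonneg (by linarith)]
        ring
  refine ⟨by positivity, hmaps, fun s hs t ht => ?_, ?_⟩
  · rcases le_total s t with h | h
    · rw [abs_sub_comm, abs_of_nonneg (by linarith)]
      exact hle s hs t ht h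
    · rw [abs_of_nonneg (by linarith), kobayashiDist_comm]
      exact hle t ht s hs h
  · obtain ⟨S₁, hS₁, hk₁⟩ := h₁.speed
    obtain ⟨S₂, hS₂, hk₂⟩ := h₂.speed
    refine ⟨S₁ ∪ ({l₁} ∪ (fun x => x + l₁) '' S₂),
      hS₁.union ((countable_singleton _).union (hS₂.image _)), fun t ht htS => ?_⟩
    simp only [mem_union, mem_singleton_iff, not_or] at htS
    obtain ⟨h1, h2, h3⟩ := htS
    rcases lt_or_gt_of_ne h2 with h | h
    · have he : concatCurve l₁ γ₁ γ₂ =ᶠ[𝓝 t] γ₁ := by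
        filter_upwards [Iio_mem_nhds h] with x hx using concatCurve_of_le _ _ (le_of_lt hx)
      rw [he.deriv_eq, he.eq_of_nhds]
      exact hk₁ t ⟨ht.1, h⟩ h1
    · have he : concatCurve l₁ γ₁ γ₂ =ᶠ[𝓝 t] fun x => γ₂ (x - l₁) := by
        filter_upwards [Ioi_mem_nhds h] with x hx using concatCurve_of_ge h0 (le_of_lt hx)
      rw [he.deriv_eq, he.eq_of_nhds, deriv_comp_sub_const]
      exact hk₂ (t - l₁) ⟨by linarith, by linarith [ht.2]⟩ fun hS => h3 ⟨_, hS, by ring⟩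

lemma isUnitSpeedCurve_const {z : CSpace d} (hz : z ∈ M) : IsUnitSpeedCurve M 0 fun _ => z :=
  ⟨le_rfl, fun _ _ => hz, fun s _ t _ => by rw [kobayashiDist_self]; positivity,
    ∅, countable_empty, fun t ht => by simp at ht⟩

lemma IsHolomorphicDisc.isUnitSpeedCurve {ψ : ℂ → CSpace d} (hψ : IsHolomorphicDisc M ψ)
    {l : ℝ} (hl : 0 ≤ l) : IsUnitSpeedCurve M l fun t => ψ (Real.tanh t : ℝ) := by
  refine ⟨hl, fun t _ => hψ.2 (tanh_ofReal_mem_unitDisc t), fun s _ t _ => ?_,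
    ∅, countable_empty, fun t _ _ => hψ.kobayashiRoyden_tanh_le t⟩
  rw [← poincareDist_tanh]
  exact (hψ.isChainLength (tanh_ofReal_mem_unitDisc s)
    (tanh_ofReal_mem_unitDisc t)).kobayashiDist_le

/-- A chain of holomorphic discs gives a unit speed curve of the same length. -/
lemma IsChainLength.exists_isUnitSpeedCurve (hM : IsEmbeddedComplexSubmanifold M)
    (hconn : IsConnected M) {z w : CSpace d} {c : ℝ} (hz : z ∈ M) (h : IsChainLength M z w c) :
    ∃ γ, IsUnitSpeedCurve M c γ ∧ γ 0 = z ∧ γ c = w := by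
  refine IsChainLength.induction
    (P := fun w c => ∃ γ, IsUnitSpeedCurve M c γ ∧ γ 0 = z ∧ γ c = w)
    ⟨_, isUnitSpeedCurve_const hz, rfl, rfl⟩ ?_ h
  rintro w c φ a b - ⟨γ, hγ, h0, h1⟩ hφ ha hb haw
  obtain ⟨ψ, l, hψ, hl, hψ0, hψ1, hlp⟩ := hφ.exists_normalized ha hb
  have hj : γ c = (fun t : ℝ => ψ (Real.tanh t : ℝ)) 0 := by simp [h1, hψ0, haw]
  rw [← hlp]
  refine ⟨_, hγ.concat hM hconn (hψ.isUnitSpeedCurve hl) hj, ?_, ?_⟩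
  · rw [concatCurve_of_le _ _ hγ.nonneg, h0]
  · rw [concatCurve_of_ge hj (by linarith), add_sub_cancel_left, hψ1]

lemma exists_isUnitSpeedCurve_lt (hM : IsEmbeddedComplexSubmanifold M) (hconn : IsConnected M)
    {z w : CSpace d} (hz : z ∈ M) (hw : w ∈ M) {r : ℝ} (hr : kobayashiDist M z w < r) :
    ∃ l < r, ∃ γ, IsUnitSpeedCurve M l γ ∧ γ 0 = z ∧ γ l = w := by
  obtain ⟨c, hc, h⟩ := exists_isChainLength_lt hM hconn hz hw hr
  exact ⟨c, hc, h.exists_isUnitSpeedCurve hM hconn hz⟩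

/-- The excess of length over distance on a subinterval is at most that of the whole curve. Absolute
continuity holds since the Kobayashi distance dominates the Euclidean one. -/
lemma IsUnitSpeedCurve.isAlmostGeodesic (hM : IsEmbeddedComplexSubmanifold M)
    (hconn : IsConnected M) (hbdd : Bornology.IsBounded M) {l kap : ℝ} {γ : ℝ → CSpace d}
    (hγ : IsUnitSpeedCurve M l γ) (hkap : 0 ≤ kap)
    (hl : l ≤ kobayashiDist M (γ 0) (γ l) + kap) : IsAlmostGeodesic M 1 kap 0 l γ := by
  have n := hγ.nonneg
  have hlow : ∀ s ∈ Icc 0 l, ∀ t ∈ Icc 0 l, s ≤ t →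
      t - s - kap ≤ kobayashiDist M (γ s) (γ t) := by
    rintro s hs t ht hst
    have h0 : (0 : ℝ) ∈ Icc 0 l := ⟨le_rfl, n⟩
    have h1 : l ∈ Icc 0 l := ⟨n, le_rfl⟩
    have a1 := hγ.dist_le 0 h0 s hs
    have a2 := hγ.dist_le t ht l h1
    rw [abs_sub_comm, abs_of_nonneg (by linarith [hs.1])] at a1
    rw [abs_sub_comm, abs_of_nonneg (by linarith [ht.2])] at a2
    have t1 := kobayashiDist_triangle hM hconn (hγ.mapsTo h0) (hγ.mapsTo hs) (hγ.mapsTo h1)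
    have t2 := kobayashiDist_triangle hM hconn (hγ.mapsTo hs) (hγ.mapsTo ht) (hγ.mapsTo h1)
    linarith
  refine ⟨n, hγ.mapsTo, fun s hs t ht => ?_, fun s hs t ht => ?_, ?_, ?_⟩
  · rcases le_total s t with h | h
    · rw [abs_of_nonneg (by linarith), kobayashiDist_comm]
      linarith [hlow s hs t ht h]
    · rw [abs_sub_comm, abs_of_nonneg (by linarith)]
      linarith [hlow t ht s hs h]
  · linarith [hγ.dist_le t ht s hs]
  · obtain ⟨C, hC, hCk⟩ := exists_dist_le_mul_kobayashiDist hM hconn hbdd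
    refine LipschitzOnWith.absolutelyContinuousOnInterval (K := ⟨C, hC.le⟩) ?_
    rw [uIcc_of_le n]
    refine LipschitzOnWith.of_dist_le_mul fun s hs t ht => ?_
    refine (hCk _ (hγ.mapsTo hs) _ (hγ.mapsTo ht)).trans ?_
    rw [Real.dist_eq]
    exact mul_le_mul_of_nonneg_left (hγ.dist_le s hs t ht) hC.le
  · obtain ⟨S, hS, hk⟩ := hγ.speed
    have hS' : (S ∪ {0, l}).Countable := hS.union (by simp)
    have h1 : ∀ᵐ t ∂(volume.restrict (Icc 0 l)), t ∉ S ∪ {0, l} :=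
      ae_restrict_of_ae (hS'.ae_notMem _)
    filter_upwards [h1, ae_restrict_mem measurableSet_Icc] with t ht htI
    simp only [mem_union, mem_insert_iff, mem_singleton_iff, not_or] at ht
    rw [ENNReal.ofReal_one]
    exact hk t ⟨lt_of_le_of_ne htI.1 (Ne.symm ht.2.1), lt_of_le_of_ne htI.2 ht.2.2⟩ ht.1

lemma joinedByAlmostGeodesics (hM : IsEmbeddedComplexSubmanifold M) (hconn : IsConnected M)
    (hbdd : Bornology.IsBounded M) {kap : ℝ} (hkap : 0 < kap) :
    JoinedByAlmostGeodesics M 1 kap := by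
  intro z hz w hw _
  obtain ⟨l, hl, γ, hγ, h0, h1⟩ := exists_isUnitSpeedCurve_lt hM hconn hz hw
    (lt_add_of_pos_right (kobayashiDist M z w) hkap)
  exact ⟨0, l, γ, hγ.isAlmostGeodesic hM hconn hbdd hkap.le (by rw [h0, h1]; exact hl.le), h0, h1⟩

/-! ### Hopf–Rinow for length spaces -/

/-- Any two points are joined by curves that are `1`-Lipschitz and whose lengths exceed the distance
of the points by arbitrarily little. -/
def HasShortCurves (X : Type*) [MetricSpace X] : Prop :=
  ∀ (x y : X) (r : ℝ), dist x y < r → ∃ (l : ℝ) (γ : ℝ → X), 0 ≤ l ∧ l < r ∧ γ 0 = x ∧ γ l = y ∧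
    ∀ s ∈ Icc 0 l, ∀ t ∈ Icc 0 l, dist (γ s) (γ t) ≤ |s - t|

section HopfRinow

variable {X : Type*} [MetricSpace X]

lemma HasShortCurves.exists_between (hX : HasShortCurves X) {x y : X} {a b : ℝ} (ha : 0 ≤ a)
    (hb : 0 < b) (h : dist x y < a + b) : ∃ z, dist x z ≤ a ∧ dist z y < b := by
  obtain ⟨l, γ, hl, hlr, h0, h1, hγ⟩ := hX x y _ h
  have hm : min a l ∈ Icc 0 l := ⟨le_min ha hl, min_le_right _ _⟩
  refine ⟨γ (min a l), ?_, ?_⟩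
  · rw [← h0]
    refine (hγ 0 ⟨le_rfl, hl⟩ _ hm).trans ?_
    rw [zero_sub, abs_neg, abs_of_nonneg hm.1]
    exact min_le_left _ _
  · rw [← h1]
    refine (hγ _ hm l ⟨hl, le_rfl⟩).trans_lt ?_
    rw [abs_sub_comm, abs_of_nonneg (sub_nonneg.2 hm.2)]
    rcases min_cases a l with h | h <;> linarith

/-- **Hopf--Rinow**: a complete, locally compact length space is proper. -/
theorem HasShortCurves.isCompact_closedBall [CompleteSpace X] [LocallyCompactSpace X]
    (hX : HasShortCurves X) (x : X) (r : ℝ) : IsCompact (Metric.closedBall x r) := by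
  by_contra hr
  set S : Set ℝ := {r | IsCompact (Metric.closedBall x r)} with hS
  have hdown : ∀ s ∈ S, ∀ t ≤ s, t ∈ S := fun s hs t hts =>
    hs.of_isClosed_subset Metric.isClosed_closedBall (Metric.closedBall_subset_closedBall hts)
  have hbdd : BddAbove S := ⟨r, fun s hs => le_of_not_ge fun h => hr (hdown s hs r h)⟩
  have h0 : (0 : ℝ) ∈ S := by simp [hS]
  set R := sSup S with hR
  have hR0 : 0 ≤ R := le_csSup hbdd h0
  have hlt : ∀ t < R, t ∈ S := fun t ht => by
    obtain ⟨s, hs, hts⟩ := exists_lt_of_lt_csSup ⟨0, h0⟩ ht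
    exact hdown s hs t hts.le
  have hRS : R ∈ S := by
    rcases hR0.eq_or_lt with h | hRpos
    · rw [← h]; exact h0
    -- Every point of the ball of radius `R` is within ε/2 of the ball of radius `a < R`, which is
    -- compact.
    refine TotallyBounded.isCompact_of_isClosed ?_ Metric.isClosed_closedBall
    rw [Metric.totallyBounded_iff]
    intro ε hε
    set a := max 0 (R - ε / 4) with ha
    have haS : a ∈ S := hlt a (max_lt hRpos (by linarith))
    obtain ⟨t, ht, hcov⟩ := Metric.totallyBounded_iff.1 haS.totallyBounded (ε / 2) (half_pos hε)
    refine ⟨t, ht, fun y hy => ?_⟩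
    rw [Metric.mem_closedBall'] at hy
    obtain ⟨z, hz1, hz2⟩ := hX.exists_between (x := x) (y := y) (a := a) (b := ε / 2)
      (le_max_left _ _) (half_pos hε) (by linarith [le_max_right 0 (R - ε / 4)])
    have hz3 := hcov (Metric.mem_closedBall'.2 hz1)
    simp only [mem_iUnion, Metric.mem_ball] at hz3 ⊢
    obtain ⟨c, hc, hzc⟩ := hz3
    exact ⟨c, hc, by linarith [dist_triangle_left y c z]⟩
  -- By local compactness the compact ball of radius `R` has a compact thickening, which contains a
  -- larger ball and contradicts the choice of `R`.
  obtain ⟨δ, hδ, hcpt⟩ := IsCompact.exists_isCompact_cthickening hRS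
  have hmem : R + δ / 2 ∈ S := by
    refine hcpt.of_isClosed_subset Metric.isClosed_closedBall fun y hy => ?_
    rw [Metric.mem_closedBall'] at hy
    obtain ⟨z, hz1, hz2⟩ := hX.exists_between (x := x) (y := y) (a := R) (b := δ) hR0 hδ
      (by linarith)
    exact Metric.mem_cthickening_of_dist_le y z δ _ (Metric.mem_closedBall'.2 hz1)
      (by rw [dist_comm]; exact hz2.le)
  linarith [le_csSup hbdd hmem]

/-- A complete, locally compact length space is geodesic. -/
theorem HasShortCurves.exists_geodesic [CompleteSpace X] [LocallyCompactSpace X]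
    (hX : HasShortCurves X) (x y : X) : ∃ γ : ℝ → X, γ 0 = x ∧ γ (dist x y) = y ∧
      ∀ s ∈ Icc 0 (dist x y), ∀ t ∈ Icc 0 (dist x y), |s - t| = dist (γ s) (γ t) := by
  set D := dist x y with hD
  have hD0 : 0 ≤ D := dist_nonneg
  have hu : ∀ n : ℕ, (0 : ℝ) < 1 / ((n : ℝ) + 1) := fun n => Nat.one_div_pos_of_nat
  choose l γ hl hlr h0 h1 hγ using fun n : ℕ => hX x y (D + 1 / ((n : ℝ) + 1))
    (lt_add_of_pos_right _ (hu n))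
  have hDl : ∀ n, D ≤ l n := fun n => by
    have := hγ n 0 ⟨le_rfl, hl n⟩ (l n) ⟨hl n, le_rfl⟩
    rwa [h0, h1, zero_sub, abs_neg, abs_of_nonneg (hl n)] at this
  have hsub : ∀ n, Icc 0 D ⊆ Icc 0 (l n) := fun n => Icc_subset_Icc_right (hDl n)
  -- An ultrafilter makes the nearly shortest curves converge at all times at once, in place of
  -- Arzelà–Ascoli.
  let U : Ultrafilter ℕ := Ultrafilter.of atTop
  have hU : (U : Filter ℕ) ≤ atTop := Ultrafilter.of_le _
  have hlim : ∀ t, ∃ z, t ∈ Icc 0 D → Tendsto (fun n => γ n t) U (𝓝 z) := by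
    intro t
    by_cases ht : t ∈ Icc 0 D
    · have hK := hX.isCompact_closedBall x D
      have hmem : ∀ n, γ n t ∈ Metric.closedBall x D := fun n => by
        rw [Metric.mem_closedBall']
        have := hγ n 0 ⟨le_rfl, hl n⟩ t (hsub n ht)
        rw [h0, zero_sub, abs_neg, abs_of_nonneg ht.1] at this
        exact this.trans ht.2
      obtain ⟨z, -, hz⟩ := hK.ultrafilter_le_nhds (U.map fun n => γ n t)
        (le_principal_iff.2 (mem_map.2 (univ_mem' hmem)))
      exact ⟨z, fun _ => hz⟩
    · exact ⟨x, fun h => absurd h ht⟩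
  choose σ hσ using hlim
  have hσ0 : σ 0 = x := by
    have := hσ 0 ⟨le_rfl, hD0⟩
    simp only [h0] at this
    exact tendsto_nhds_unique this tendsto_const_nhds
  have hσ1 : σ D = y := by
    have h2 : Tendsto (fun n => γ n D) atTop (𝓝 y) := by
      rw [tendsto_iff_dist_tendsto_zero]
      refine squeeze_zero (fun _ => dist_nonneg) (fun n => ?_)
        (tendsto_one_div_add_atTop_nhds_zero_nat (𝕜 := ℝ))
      have := hγ n D ⟨hD0, hDl n⟩ (l n) ⟨hl n, le_rfl⟩
      rw [h1, abs_sub_comm, abs_of_nonneg (sub_nonneg.2 (hDl n))] at this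
      linarith [hlr n]
    exact tendsto_nhds_unique (hσ D ⟨hD0, le_rfl⟩) (h2.mono_left hU)
  have hLip : ∀ s ∈ Icc 0 D, ∀ t ∈ Icc 0 D, dist (σ s) (σ t) ≤ |s - t| := fun s hs t ht =>
    le_of_tendsto ((hσ s hs).dist (hσ t ht))
      (Eventually.of_forall fun n => hγ n s (hsub n hs) t (hsub n ht))
  have hgeo : ∀ s ∈ Icc 0 D, ∀ t ∈ Icc 0 D, s ≤ t → t - s = dist (σ s) (σ t) := by
    intro s hs t ht hst
    have a1 := hLip 0 ⟨le_rfl, hD0⟩ s hs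
    have a2 := hLip t ht D ⟨hD0, le_rfl⟩
    have a3 := hLip s hs t ht
    rw [abs_sub_comm, abs_of_nonneg (by linarith [hs.1, ht.2])] at a1 a2 a3
    rw [hσ0] at a1
    rw [hσ1] at a2
    -- The three Lipschitz bounds add up to `D`, so each is an equality.
    linarith [dist_triangle4 x (σ s) (σ t) y]
  refine ⟨σ, hσ0, hσ1, fun s hs t ht => ?_⟩
  rcases le_total s t with h | h
  · rw [abs_sub_comm, abs_of_nonneg (sub_nonneg.2 h), hgeo s hs t ht h]
  · rw [abs_of_nonneg (sub_nonneg.2 h), dist_comm, hgeo t ht s hs h]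

end HopfRinow

/-! ### The Kobayashi metric is proper and geodesic -/

/-- The Kobayashi distance as a metric on a bounded connected submanifold, compatible with the
subspace topology. -/
noncomputable abbrev kobayashiMetricSpace (hM : IsEmbeddedComplexSubmanifold M)
    (hconn : IsConnected M) (hbdd : Bornology.IsBounded M) : MetricSpace M :=
  MetricSpace.ofDistTopology (fun x y => kobayashiDist M x y) (fun _ => kobayashiDist_self _)
    (fun _ _ => kobayashiDist_comm _ _)
    (fun x y z => kobayashiDist_triangle hM hconn x.2 y.2 z.2)
    (by
      obtain ⟨C, hC, hCk⟩ := exists_dist_le_mul_kobayashiDist hM hconn hbdd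
      intro s
      rw [isOpen_iff_mem_nhds]
      refine forall₂_congr fun x _ => ⟨fun h => ?_, ?_⟩
      · obtain ⟨ε, hε, hs⟩ := Metric.mem_nhds_iff.1 h
        refine ⟨ε / C, by positivity, fun y hy => hs ?_⟩
        rw [lt_div_iff₀' hC] at hy
        exact Metric.mem_ball'.2 ((hCk x x.2 y y.2).trans_lt hy)
      · rintro ⟨ε, hε, hs⟩
        have h1 := (tendsto_kobayashiDist hM x.2).eventually (gt_mem_nhds hε)
        rw [← map_nhds_subtype_val] at h1
        exact mem_of_superset h1 hs)
    (fun x y h => by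
      obtain ⟨C, hC, hCk⟩ := exists_dist_le_mul_kobayashiDist hM hconn hbdd
      have := hCk x x.2 y y.2
      rw [h, mul_zero] at this
      exact Subtype.ext (dist_le_zero.1 this))

/-- The abstract copy `X` keeps the Kobayashi metric apart from the Euclidean metric that M inherits
as a subset. -/
lemma hopfRinow_of_isometry {X : Type*} [MetricSpace X] [LocallyCompactSpace X]
    (hM : IsEmbeddedComplexSubmanifold M) (hconn : IsConnected M)
    (hcomplete : IsKobayashiComplete M) (e : X → CSpace d) (he : Continuous e)
    (hr : range e = M) (hd : ∀ x y, dist x y = kobayashiDist M (e x) (e y)) :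
    (∀ x ∈ M, ∀ r : ℝ, IsCompact {z | z ∈ M ∧ kobayashiDist M x z ≤ r}) ∧
    (∀ x ∈ M, ∀ y ∈ M, ∃ γ : ℝ → CSpace d, γ 0 = x ∧ γ (kobayashiDist M x y) = y ∧
      IsRealKobayashiGeodesic M 0 (kobayashiDist M x y) γ) := by
  have heM : ∀ x, e x ∈ M := fun x => hr ▸ mem_range_self x
  have hsurj : ∀ y ∈ M, ∃ x, e x = y := fun y hy => by rwa [← hr] at hy
  have hX : HasShortCurves X := by
    intro x y r hxy
    rw [hd] at hxy
    obtain ⟨l, hl, γ, hγ, h0, h1⟩ := exists_isUnitSpeedCurve_lt hM hconn (heM x) (heM y) hxy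
    have hinj : ∀ a b, e a = e b → a = b := fun a b h => by
      rw [← dist_eq_zero, hd, h, kobayashiDist_self]
    have hlift : ∀ t, ∃ z, t ∈ Icc 0 l → e z = γ t := fun t => by
      by_cases ht : t ∈ Icc 0 l
      · exact (hsurj _ (hγ.mapsTo ht)).imp fun _ h _ => h
      · exact ⟨x, fun h => absurd h ht⟩
    choose g hg using hlift
    refine ⟨l, g, hγ.nonneg, hl, hinj _ _ ?_, hinj _ _ ?_, fun s hs t ht => ?_⟩
    · rw [hg 0 ⟨le_rfl, hγ.nonneg⟩, h0]
    · rw [hg l ⟨hγ.nonneg, le_rfl⟩, h1]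
    · rw [hd, hg s hs, hg t ht]
      exact hγ.dist_le s hs t ht
  have hcs : CompleteSpace X := by
    refine Metric.complete_of_cauchySeq_tendsto fun u hu => ?_
    obtain ⟨z, hz, hlim⟩ := hcomplete (fun n => e (u n)) (fun n => heM _)
      (fun ε hε => by simpa only [hd] using Metric.cauchySeq_iff.1 hu ε hε)
    obtain ⟨w, rfl⟩ := hsurj z hz
    exact ⟨w, tendsto_iff_dist_tendsto_zero.2 (by simpa only [hd] using hlim)⟩
  refine ⟨fun x hx r => ?_, fun x hx y hy => ?_⟩
  · obtain ⟨x, rfl⟩ := hsurj x hx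
    convert (hX.isCompact_closedBall x r).image he using 1
    ext z
    constructor
    · rintro ⟨hz, hzr⟩
      obtain ⟨z, rfl⟩ := hsurj z hz
      exact ⟨z, by rwa [Metric.mem_closedBall', hd], rfl⟩
    · rintro ⟨z, hz, rfl⟩
      rw [Metric.mem_closedBall', hd] at hz
      exact ⟨heM z, hz⟩
  · obtain ⟨x, rfl⟩ := hsurj x hx
    obtain ⟨y, rfl⟩ := hsurj y hy
    obtain ⟨γ, h0, h1, hγ⟩ := hX.exists_geodesic x y
    simp only [hd] at h1 hγ
    exact ⟨fun t => e (γ t), congrArg e h0, congrArg e h1, kobayashiDist_nonneg _ _,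
      fun t _ => heM _, hγ⟩

lemma isCompact_kobayashi_closedBall_and_exists_geodesic (hM : IsEmbeddedComplexSubmanifold M)
    (hconn : IsConnected M) (hbdd : Bornology.IsBounded M) (hcomplete : IsKobayashiComplete M) :
    (∀ x ∈ M, ∀ r : ℝ, IsCompact {z | z ∈ M ∧ kobayashiDist M x z ≤ r}) ∧
    (∀ x ∈ M, ∀ y ∈ M, ∃ γ : ℝ → CSpace d, γ 0 = x ∧ γ (kobayashiDist M x y) = y ∧
      IsRealKobayashiGeodesic M 0 (kobayashiDist M x y) γ) := by
  have hlc : LocallyCompactSpace M := hM.isLocallyClosed.locallyCompactSpace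
  exact @hopfRinow_of_isometry d M M (kobayashiMetricSpace hM hconn hbdd) hlc hM hconn hcomplete
    Subtype.val continuous_subtype_val Subtype.range_val fun _ _ => rfl

lemma continuousOn_kobayashiDist (hM : IsEmbeddedComplexSubmanifold M) (hconn : IsConnected M)
    {x : CSpace d} (hx : x ∈ M) : ContinuousOn (fun z => kobayashiDist M x z) M := by
  intro y hy
  refine tendsto_iff_dist_tendsto_zero.2 (squeeze_zero' (Eventually.of_forall fun _ => dist_nonneg)
    ?_ (tendsto_kobayashiDist hM hy))
  filter_upwards [self_mem_nhdsWithin] with z hz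
  have h1 := kobayashiDist_triangle hM hconn hx hy hz
  have h2 := kobayashiDist_triangle hM hconn hx hz hy
  rw [kobayashiDist_comm z y] at h2
  rw [Real.dist_eq, abs_le]
  constructor <;> linarith

/-! ### Gromov products: from geodesics to almost-geodesics -/

/-- If the geodesics bend inside `M`, then the Gromov product is bounded near any pair of distinct
boundary points. -/
lemma BendsInside.exists_gromov_bound (hM : IsEmbeddedComplexSubmanifold M)
    (hconn : IsConnected M) (hbdd : Bornology.IsBounded M) (hcomplete : IsKobayashiComplete M)
    (hvis : BendsInside M (IsRealKobayashiGeodesic M)) {o p q : CSpace d} (ho : o ∈ M)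
    (hp : p ∈ closure M \ M) (hq : q ∈ closure M \ M) (hpq : p ≠ q) :
    ∃ V ∈ 𝓝 p, ∃ W ∈ 𝓝 q, ∃ C : ℝ, ∀ x ∈ V, x ∈ M → ∀ y ∈ W, y ∈ M →
      kobayashiDist M o x + kobayashiDist M o y ≤ kobayashiDist M x y + C := by
  obtain ⟨V, hV, W, hW, K, -, hK, hKM, h⟩ := hvis p hp q hq hpq
  obtain ⟨C, hC⟩ := hK.bddAbove_image ((continuousOn_kobayashiDist hM hconn ho).mono hKM)
  refine ⟨V, hV, W, hW, 2 * C, fun x hxV hx y hyW hy => ?_⟩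
  obtain ⟨γ, h0, h1, hγ⟩ :=
    (isCompact_kobayashi_closedBall_and_exists_geodesic hM hconn hbdd hcomplete).2 x hx y hy
  obtain ⟨t, ht, htK⟩ := h _ _ γ hγ (by rwa [h0]) (by rwa [h1])
  have hz := hKM htK
  have e0 := hγ.isometry 0 ⟨le_rfl, hγ.le⟩ t ht
  have e1 := hγ.isometry t ht _ ⟨hγ.le, le_rfl⟩
  rw [abs_sub_comm, abs_of_nonneg (by linarith [ht.1]), h0] at e0
  rw [abs_sub_comm, abs_of_nonneg (by linarith [ht.2]), h1] at e1
  have hoz : kobayashiDist M o (γ t) ≤ C := hC (mem_image_of_mem _ htK)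
  have t1 := kobayashiDist_triangle hM hconn ho hz hx
  have t2 := kobayashiDist_triangle hM hconn ho hz hy
  rw [kobayashiDist_comm (γ t) x] at t1
  linarith

/-- Two upper bounds and one lower bound each cost one `kap`. -/
lemma IsAlmostGeodesic.kobayashiDist_add_le {kap a b : ℝ} {σ : ℝ → CSpace d}
    (h : IsAlmostGeodesic M 1 kap a b σ) {t : ℝ} (ht : t ∈ Icc a b) :
    kobayashiDist M (σ a) (σ t) + kobayashiDist M (σ t) (σ b) ≤
      kobayashiDist M (σ a) (σ b) + 3 * kap := by
  have ha : a ∈ Icc a b := ⟨le_rfl, h.le⟩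
  have hb : b ∈ Icc a b := ⟨h.le, le_rfl⟩
  have h1 := h.upper t ht a ha
  have h2 := h.upper b hb t ht
  have h3 := h.lower b hb a ha
  rw [abs_sub_comm, abs_of_nonneg (by linarith [ht.1])] at h1
  rw [abs_sub_comm, abs_of_nonneg (by linarith [ht.2])] at h2
  rw [abs_sub_comm, abs_of_nonneg (by linarith [h.le])] at h3
  linarith

/-- Only the distance estimates and the continuity of almost-geodesics enter, not the speed bound,
so `kap = 0` needs no separate treatment. -/
theorem BendsInside.almostGeodesic_of_geodesic (hM : IsEmbeddedComplexSubmanifold M)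
    (hconn : IsConnected M) (hbdd : Bornology.IsBounded M) (hcomplete : IsKobayashiComplete M)
    (hvis : BendsInside M (IsRealKobayashiGeodesic M)) (kap : ℝ) :
    BendsInside M (IsAlmostGeodesic M 1 kap) := by
  obtain ⟨o, ho⟩ := hconn.nonempty
  intro p hp q hq hpq
  obtain ⟨V₀, hV₀, W₀, hW₀, C₀, hC₀⟩ :=
    hvis.exists_gromov_bound hM hconn hbdd hcomplete ho hp hq hpq
  by_contra hcon
  push Not at hcon
  have hD : 0 < dist p q := dist_pos.2 hpq
  -- Radii at most a third of the distance between `p` and `q` give the disjoint closures needed to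
  -- use the negated visibility condition.
  let δ : ℕ → ℝ := fun n => dist p q / 3 * (1 / ((n : ℝ) + 1))
  have hδ : ∀ n, 0 < δ n := fun n => mul_pos (by positivity) Nat.one_div_pos_of_nat
  have hδle : ∀ n, δ n ≤ dist p q / 3 := fun n =>
    mul_le_of_le_one_right (by positivity)
      ((div_le_one (by positivity)).2 (by linarith [n.cast_nonneg (α := ℝ)]))
  have hδlim : Tendsto δ atTop (𝓝 0) := by
    simpa only [mul_zero] using
      (tendsto_one_div_add_atTop_nhds_zero_nat (𝕜 := ℝ)).const_mul (dist p q / 3)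
  have hdisj : ∀ n, closure (Metric.ball p (δ n) ∩ V₀) ∩ closure (Metric.ball q (δ n) ∩ W₀) = ∅ := by
    intro n
    have h1 : Disjoint (Metric.closedBall p (δ n)) (Metric.closedBall q (δ n)) :=
      Metric.closedBall_disjoint_closedBall (by linarith [hδle n])
    refine (h1.mono ?_ ?_).inter_eq <;>
    exact (closure_mono inter_subset_left).trans Metric.closure_ball_subset_closedBall
  choose a b σ hσ hσa hσb havoid using fun n : ℕ => hcon (Metric.ball p (δ n) ∩ V₀)
    (inter_mem (Metric.ball_mem_nhds p (hδ n)) hV₀) (Metric.ball q (δ n) ∩ W₀)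
    (inter_mem (Metric.ball_mem_nhds q (hδ n)) hW₀) {z | z ∈ M ∧ kobayashiDist M o z ≤ n + C₀}
    (hdisj n) ((isCompact_kobayashi_closedBall_and_exists_geodesic hM hconn hbdd hcomplete).1 o ho _)
    (fun z hz => hz.1)
  have ha : ∀ n, a n ∈ Icc (a n) (b n) := fun n => ⟨le_rfl, (hσ n).le⟩
  have hb : ∀ n, b n ∈ Icc (a n) (b n) := fun n => ⟨(hσ n).le, le_rfl⟩
  have hfar : ∀ n, ∀ t ∈ Icc (a n) (b n), n + C₀ < kobayashiDist M o (σ n t) := fun n t ht =>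
    lt_of_not_ge fun h => havoid n t ht ⟨(hσ n).mapsTo ht, h⟩
  -- The value is attained because k(o,y) > C₀ and the Gromov bound give k(o,x) < k(x,y), for the
  -- endpoints x, y; this is why C₀ was added to the radius of the avoided ball.
  have hmid : ∀ n, ∃ t ∈ Icc (a n) (b n),
      kobayashiDist M (σ n (a n)) (σ n t) = kobayashiDist M o (σ n (a n)) := by
    intro n
    have hcont : ContinuousOn (fun t => kobayashiDist M (σ n (a n)) (σ n t)) (Icc (a n) (b n)) := by
      refine (continuousOn_kobayashiDist hM hconn ((hσ n).mapsTo (ha n))).comp ?_ (hσ n).mapsTo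
      have := (hσ n).absolutelyContinuous.continuousOn
      rwa [uIcc_of_le (hσ n).le] at this
    refine intermediate_value_Icc (hσ n).le hcont ⟨?_, ?_⟩
    · rw [kobayashiDist_self]
      exact kobayashiDist_nonneg _ _
    · have h1 := hC₀ _ (hσa n).2 ((hσ n).mapsTo (ha n)) _ (hσb n).2 ((hσ n).mapsTo (hb n))
      have h2 := hfar n _ (hb n)
      linarith [n.cast_nonneg (α := ℝ)]
  choose t ht htmid using hmid
  have hzM : ∀ n, σ n (t n) ∈ M := fun n => (hσ n).mapsTo (ht n)
  have hxlim : Tendsto (fun n => σ n (a n)) atTop (𝓝 p) :=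
    tendsto_iff_dist_tendsto_zero.2
      (squeeze_zero (fun _ => dist_nonneg) (fun n => (Metric.mem_ball.1 (hσa n).1).le) hδlim)
  have hylim : Tendsto (fun n => σ n (b n)) atTop (𝓝 q) :=
    tendsto_iff_dist_tendsto_zero.2
      (squeeze_zero (fun _ => dist_nonneg) (fun n => (Metric.mem_ball.1 (hσb n).1).le) hδlim)
  obtain ⟨ξ, hξ, f, hf, hlim⟩ := hbdd.isCompact_closure.tendsto_subseq
    (fun n => subset_closure (hzM n))
  have hfN : ∀ C : ℝ, ∀ᶠ n in atTop, C < kobayashiDist M o (σ (f n) (t (f n))) := by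
    intro C
    filter_upwards [(tendsto_natCast_atTop_atTop.comp hf.tendsto_atTop).eventually_gt_atTop
      (C - C₀)] with n hn
    have := hfar (f n) _ (ht (f n))
    simp only [Function.comp] at hn
    linarith
  have hξM : ξ ∉ M := by
    intro hmem
    have h1 := (continuousOn_kobayashiDist hM hconn ho ξ hmem).tendsto.comp
      (tendsto_nhdsWithin_iff.2 ⟨hlim, Eventually.of_forall fun n => hzM (f n)⟩)
    obtain ⟨n, hn1, hn2⟩ := ((h1.eventually (gt_mem_nhds (lt_add_one _))).and
      (hfN (kobayashiDist M o ξ + 1))).exists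
    exact lt_asymm hn1 hn2
  by_cases hξp : ξ = p
  -- Here k(z,y) ≤ k(x,y) + 3κ - k(x,z) ≤ k(o,y) + 3κ, so the Gromov bound for (z,y) gives k(o,z) ≤
  -- C + 3κ.
  · have hξq : ξ ≠ q := hξp ▸ hpq
    obtain ⟨V, hV, W, hW, C, hC⟩ :=
      hvis.exists_gromov_bound hM hconn hbdd hcomplete ho ⟨hξ, hξM⟩ hq hξq
    obtain ⟨n, hn1, hn2, hn3⟩ := ((hlim.eventually hV).and
      (((hylim.comp hf.tendsto_atTop).eventually hW).and (hfN (C + 3 * kap)))).exists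
    have h1 := hC _ hn1 (hzM (f n)) _ hn2 ((hσ (f n)).mapsTo (hb (f n)))
    have h2 := (hσ (f n)).kobayashiDist_add_le (ht (f n))
    have h3 := kobayashiDist_triangle hM hconn ((hσ (f n)).mapsTo (ha (f n))) ho
      ((hσ (f n)).mapsTo (hb (f n)))
    rw [kobayashiDist_comm (σ (f n) (a (f n))) o] at h3
    have h4 := htmid (f n)
    simp only [Function.comp] at h1
    linarith
  -- Since k(x,z) = k(o,x), the Gromov bound for (x,z) reduces to k(o,z) ≤ C.
  · obtain ⟨V, hV, W, hW, C, hC⟩ :=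
      hvis.exists_gromov_bound hM hconn hbdd hcomplete ho hp ⟨hξ, hξM⟩ (Ne.symm hξp)
    obtain ⟨n, hn1, hn2, hn3⟩ := (((hxlim.comp hf.tendsto_atTop).eventually hV).and
      ((hlim.eventually hW).and (hfN C))).exists
    have h1 := hC _ hn1 ((hσ (f n)).mapsTo (ha (f n))) _ hn2 (hzM (f n))
    have h4 := htmid (f n)
    simp only [Function.comp] at h1
    linarith

/-! ### Approximation of geodesics: from almost-geodesics to geodesics -/

lemma IsRealKobayashiGeodesic.mono {a b a' b' : ℝ} {σ : ℝ → CSpace d}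
    (h : IsRealKobayashiGeodesic M a b σ) (ha : a ≤ a') (hab : a' ≤ b') (hb : b' ≤ b) :
    IsRealKobayashiGeodesic M a' b' σ :=
  ⟨hab, h.mapsTo.mono_left (Icc_subset_Icc ha hb), fun s hs t ht =>
    h.isometry s (Icc_subset_Icc ha hb hs) t (Icc_subset_Icc ha hb ht)⟩

/-- Real geodesics are approximated by unit speed curves of almost the same length. -/
lemma IsRealKobayashiGeodesic.exists_isUnitSpeedCurve (hM : IsEmbeddedComplexSubmanifold M)
    (hconn : IsConnected M) {a b : ℝ} {σ : ℝ → CSpace d} (h : IsRealKobayashiGeodesic M a b σ)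
    {ε : ℝ} (hε : 0 < ε) :
    ∃ l < b - a + ε, ∃ γ, IsUnitSpeedCurve M l γ ∧ γ 0 = σ a ∧ γ l = σ b ∧
      ∀ t ∈ Icc 0 l, ∃ s ∈ Icc a b, kobayashiDist M (γ t) (σ s) ≤ 1 + ε := by
  obtain ⟨n, hn⟩ := exists_nat_ge (b - a)
  induction n generalizing b ε with
  | zero =>
    have hab : a = b := le_antisymm h.le (by simpa using hn)
    subst hab
    refine ⟨0, by linarith, fun _ => σ a, isUnitSpeedCurve_const (h.mapsTo ⟨le_rfl, le_rfl⟩), rfl,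
      rfl, fun t _ => ⟨a, ⟨le_rfl, le_rfl⟩, ?_⟩⟩
    rw [kobayashiDist_self]
    positivity
  | succ n ih =>
    -- Split off a last piece of length at most 1; it and the rest each receive half of the
    -- permitted excess.
    set c := max a (b - 1) with hc
    have hac : a ≤ c := le_max_left _ _
    have hcb : c ≤ b := max_le h.le (by linarith)
    have hbc : b - 1 ≤ c := le_max_right _ _
    push_cast at hn
    have hcn : c - a ≤ n := by
      rw [sub_le_iff_le_add]
      exact max_le (by linarith [n.cast_nonneg (α := ℝ)]) (by linarith)
    obtain ⟨l₁, hl₁, γ₁, hγ₁, h₁0, h₁1, hs₁⟩ := ih (h.mono le_rfl hac hcb) (half_pos hε) hcn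
    have hk : kobayashiDist M (σ c) (σ b) = b - c := by
      rw [← h.isometry c ⟨hac, hcb⟩ b ⟨h.le, le_rfl⟩, abs_sub_comm,
        abs_of_nonneg (sub_nonneg.2 hcb)]
    obtain ⟨l₂, hl₂, γ₂, hγ₂, h₂0, h₂1⟩ := exists_isUnitSpeedCurve_lt hM hconn
      (h.mapsTo ⟨hac, hcb⟩) (h.mapsTo ⟨h.le, le_rfl⟩)
      (r := b - c + ε / 2) (by rw [hk]; linarith)
    have hj : γ₁ l₁ = γ₂ 0 := h₁1.trans h₂0.symm
    have n₁ := hγ₁.nonneg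
    have n₂ := hγ₂.nonneg
    refine ⟨l₁ + l₂, by linarith, _, hγ₁.concat hM hconn hγ₂ hj, ?_, ?_, fun t ht => ?_⟩
    · rw [concatCurve_of_le _ _ n₁, h₁0]
    · rw [concatCurve_of_ge hj (by linarith), add_sub_cancel_left, h₂1]
    · rcases le_total t l₁ with htl | htl
      · rw [concatCurve_of_le _ _ htl]
        obtain ⟨s, hs, hks⟩ := hs₁ t ⟨ht.1, htl⟩
        exact ⟨s, ⟨hs.1, hs.2.trans hcb⟩, by linarith⟩
      · rw [concatCurve_of_ge hj htl]
        -- The whole last piece of the new curve has length below 1 + ε/2, so its endpoint is close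
        -- enough to each of its points.
        refine ⟨b, ⟨h.le, le_rfl⟩, ?_⟩
        have := hγ₂.dist_le (t - l₁) ⟨by linarith, by linarith [ht.2]⟩ l₂ ⟨n₂, le_rfl⟩
        rw [h₂1, abs_sub_comm, abs_of_nonneg (by linarith [ht.2])] at this
        linarith

theorem BendsInside.geodesic_of_almostGeodesic (hM : IsEmbeddedComplexSubmanifold M)
    (hconn : IsConnected M) (hbdd : Bornology.IsBounded M) (hcomplete : IsKobayashiComplete M)
    {kap : ℝ} (hkap : 0 < kap) (hvis : BendsInside M (IsAlmostGeodesic M 1 kap)) :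
    BendsInside M (IsRealKobayashiGeodesic M) := by
  obtain ⟨o, ho⟩ := hconn.nonempty
  intro p hp q hq hpq
  obtain ⟨V, hV, W, hW, K, hVW, hK, hKM, h⟩ := hvis p hp q hq hpq
  obtain ⟨C, hC⟩ := hK.bddAbove_image ((continuousOn_kobayashiDist hM hconn ho).mono hKM)
  refine ⟨V, hV, W, hW, {z | z ∈ M ∧ kobayashiDist M o z ≤ C + (1 + kap)}, hVW,
    (isCompact_kobayashi_closedBall_and_exists_geodesic hM hconn hbdd hcomplete).1 o ho _,
    fun z hz => hz.1, fun a b σ hσ haV hbW => ?_⟩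
  obtain ⟨l, hl, γ, hγ, h0, h1, hs⟩ := hσ.exists_isUnitSpeedCurve hM hconn hkap
  have hk : kobayashiDist M (σ a) (σ b) = b - a := by
    rw [← hσ.isometry a ⟨le_rfl, hσ.le⟩ b ⟨hσ.le, le_rfl⟩, abs_sub_comm,
      abs_of_nonneg (sub_nonneg.2 hσ.le)]
  obtain ⟨t, ht, htK⟩ := h 0 l γ
    (hγ.isAlmostGeodesic hM hconn hbdd hkap.le (by rw [h0, h1, hk]; exact hl.le))
    (h0 ▸ haV) (h1 ▸ hbW)
  obtain ⟨s, hsI, hks⟩ := hs t ht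
  have hoz : kobayashiDist M o (γ t) ≤ C := hC (mem_image_of_mem _ htK)
  exact ⟨s, hsI, hσ.mapsTo hsI,
    (kobayashiDist_triangle hM hconn ho (hKM htK) (hσ.mapsTo hsI)).trans (add_le_add hoz hks)⟩

end

theorem mainTheorem9 {d : ℕ} (M : Set (CSpace d))
    (hM : IsEmbeddedComplexSubmanifold M) (hconn : IsConnected M)
    (hbdd : Bornology.IsBounded M) (hcomplete : IsKobayashiComplete M) :
    IsBNTVisibilitySubmanifold M ↔
      ∀ kap : ℝ, 0 ≤ kap → IsVisibilitySubmanifold M 1 kap :=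
  ⟨fun h kap _ => ⟨fun hkap => joinedByAlmostGeodesics hM hconn hbdd hkap,
      h.2.almostGeodesic_of_geodesic hM hconn hbdd hcomplete kap⟩,
    -- Any positive `kap` would do; `kap = 0` would not serve here, since the approximating curves
    -- have positive excess.
    fun h => ⟨hcomplete,
      (h 1 zero_le_one).2.geodesic_of_almostGeodesic hM hconn hbdd hcomplete one_pos⟩⟩
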